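/- Let $a<b$ and $c\le d$ be real numbers, let $f:[a,b]\to\mathbb{R}$ be Lipschitz and let $g:[c,d]\to\mathbb{R}$ be continuous. Define $h_1,h_2:[a,b]\times[c,d]\to\mathbb{R}$ by $h_1(x,y)=f(x)+g(y)$ and $h_2(x,y)=f(x)g(y)$. Let $G_g=\{(y,g(y)):y\in[c,d]\}\subseteq\mathbb{R}^2$ and $G_{h_i}=\{(x,y,h_i(x,y)):x\in[a,b],\,y\in[c,d]\}\subseteq\mathbb{R}^3$ denote the graphs, where $\mathbb{R}^2$ and $\mathbb{R}^3$ carry the Euclidean metric, and let $\dim_H$ denote Hausdorff dimension. Then $$\dim_H(G_{h_1})=\dim_H(G_g)+1\qquad\text{and}\qquad \dim_H(G_{h_2})\le\dim_H(G_g)+1.$$ -/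

import Mathlib

/-- The graph `{(y, g y) : y ∈ A}` of `g : A → ℝ`, `A ⊆ ℝ`, in the Euclidean plane. -/
def curveGraph {A : Set ℝ} (g : A → ℝ) : Set (EuclideanSpace ℝ (Fin 2)) :=
  Set.range fun y : A => !₂[(y : ℝ), g y]

/-- The graph `{(x, y, h (x, y)) : x ∈ A, y ∈ B}` of `h : A × B → ℝ`, `A, B ⊆ ℝ`,
in Euclidean three-space. -/
def surfaceGraph {A B : Set ℝ} (h : A × B → ℝ) : Set (EuclideanSpace ℝ (Fin 3)) :=
  Set.range fun p : A × B => !₂[(p.1 : ℝ), (p.2 : ℝ), h p]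

open Set Filter Topology MeasureTheory Measure Metric
open scoped ENNReal NNReal

/-! Both surfaces are images of `[a, b] × G_g` under `(x, (y, z)) ↦ (x, y, φ (f x, z))`, with `φ`
the sum or the product. This map is locally Lipschitz, so it does not raise dimension. For the sum,
`(x, y, w) ↦ (x, (y, w - f x))` is a locally Lipschitz inverse, whence equality; for the product,
zeros of `f` destroy injectivity. It remains to see that a factor `[a, b]` adds exactly one
(`dimH_Icc_prod`): above by cutting covers into cubes, below by a Fubini argument on slices. -/

/-- A set of zero Hausdorff measure has covers by sets of diameter at most `r n` with
arbitrarily small sum of powers. -/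
theorem exists_cover_tsum_rpow_le {X : Type*} [EMetricSpace X] [MeasurableSpace X] [BorelSpace X]
    {E : Set X} {s : ℝ} (hs : 0 < s) (hE : μH[s] E = 0) {ε : ℝ≥0∞} (hε : ε ≠ 0) :
    ∃ (t : ℕ → Set X) (r : ℕ → ℝ≥0), E ⊆ ⋃ n, t n ∧ (∀ n, 0 < r n) ∧
      (∀ n, ediam (t n) ≤ r n) ∧ ∑' n, (r n : ℝ≥0∞) ^ s ≤ ε := by
  have hε2 : ε / 2 ≠ 0 := (ENNReal.half_pos hε).ne'
  rw [hausdorffMeasure_apply] at hE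
  have h1 := ENNReal.iSup_eq_zero.1 (ENNReal.iSup_eq_zero.1 hE 1) one_pos
  have h2 := h1.trans_lt (pos_iff_ne_zero.2 hε2)
  simp only [iInf_lt_iff] at h2
  obtain ⟨t, htE, ht1, hsum⟩ := h2
  obtain ⟨δ, hδ0, hδ⟩ := ENNReal.exists_pos_sum_of_countable hε2 ℕ
  have hfin : ∀ n, (ediam (t n) ^ s + δ n) ^ s⁻¹ ≠ ∞ := fun n =>
    ENNReal.rpow_ne_top_of_nonneg (by positivity) (ENNReal.add_ne_top.2
      ⟨ENNReal.rpow_ne_top_of_nonneg hs.le ((ht1 n).trans_lt ENNReal.one_lt_top).ne,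
        ENNReal.coe_ne_top⟩)
  -- The summable `δ n` keeps the radius positive even when `t n` is a point, so that it can be
  -- divided by later.
  refine ⟨t, fun n => ((ediam (t n) ^ s + δ n) ^ s⁻¹).toNNReal, htE, fun n => ?_,
    fun n => ?_, ?_⟩
  · refine ENNReal.toNNReal_pos (ENNReal.rpow_pos ?_ ?_).ne' (hfin n)
    · exact (ENNReal.coe_pos.2 (hδ0 n)).trans_le le_add_self
    · intro h
      exact hfin n (by rw [h, ENNReal.top_rpow_of_pos (by positivity)])
  · rw [ENNReal.coe_toNNReal (hfin n), ENNReal.le_rpow_inv_iff hs]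
    exact le_self_add
  · calc ∑' n, ((((ediam (t n) ^ s + δ n) ^ s⁻¹).toNNReal : ℝ≥0) : ℝ≥0∞) ^ s
        = ∑' n, (ediam (t n) ^ s + δ n) := by
          refine tsum_congr fun n => ?_
          rw [ENNReal.coe_toNNReal (hfin n), ← ENNReal.rpow_mul, inv_mul_cancel₀ hs.ne',
            ENNReal.rpow_one]
      _ = ∑' n, ediam (t n) ^ s + ∑' n, (δ n : ℝ≥0∞) := ENNReal.tsum_add
      _ ≤ ε / 2 + ε / 2 := by
          refine add_le_add (le_trans (ENNReal.tsum_le_tsum fun n => ?_) hsum.le) hδ.le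
          rcases (t n).eq_empty_or_nonempty with h | h
          · simp [h, hs]
          · exact le_iSup (fun _ : (t n).Nonempty => ediam (t n) ^ s) h
      _ = ε := ENNReal.add_halves ε

theorem ediam_prod_le {X Y : Type*} [PseudoEMetricSpace X] [PseudoEMetricSpace Y]
    {s : Set X} {t : Set Y} {r : ℝ≥0∞} (hs : ediam s ≤ r) (ht : ediam t ≤ r) :
    ediam (s ×ˢ t) ≤ r :=
  ediam_le fun p hp q hq => by
    rw [Prod.edist_eq]
    exact max_le ((edist_le_ediam_of_mem hp.1 hq.1).trans hs)
      ((edist_le_ediam_of_mem hp.2 hq.2).trans ht)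

/-- Covers of `E` subdivide to covers of `[a, b] × E`. -/
theorem exists_cover_Icc_prod {X : Type*} [EMetricSpace X] [MeasurableSpace X] [BorelSpace X]
    {E : Set X} {s : ℝ} (hs : 0 < s) (hE : μH[s] E = 0) (a b : ℝ) {ε : ℝ≥0∞} (hε : ε ≠ 0)
    (hε' : ε ≤ 1) :
    ∃ T : ℕ × ℕ → Set (ℝ × X), Icc a b ×ˢ E ⊆ ⋃ i, T i ∧ (∀ i, ediam (T i) ≤ ε ^ s⁻¹) ∧
      ∑' i, ediam (T i) ^ (s + 1) ≤ (ENNReal.ofReal (b - a) + 1) * ε := by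
  obtain ⟨t, r, htE, hr0, htr, hsum⟩ :=
    exists_cover_tsum_rpow_le hs hE hε
  have hrε : ∀ n, (r n : ℝ≥0∞) ≤ ε ^ s⁻¹ := fun n =>
    (ENNReal.le_rpow_inv_iff hs).2 ((ENNReal.le_tsum n).trans hsum)
  have hr1 : ∀ n, (r n : ℝ≥0∞) ≤ 1 := fun n =>
    (hrε n).trans (ENNReal.rpow_le_one hε' (by positivity))
  set L : ℝ≥0 := (b - a).toNNReal with hL
  -- About `L / r n` intervals of length `r n` cover `[a, b]`; the remaining indices give `∅`, which
  -- adds nothing to the sum.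
  let T : ℕ × ℕ → Set (ℝ × X) := fun i =>
    if i.2 ≤ ⌊L / r i.1⌋₊ then Icc (a + i.2 * r i.1) (a + (i.2 + 1) * r i.1) ×ˢ t i.1 else ∅
  have hT : ∀ i, ediam (T i) ≤ r i.1 := by
    intro i
    simp only [T]
    split_ifs with h
    · refine ediam_prod_le ?_ (htr _)
      rw [Real.ediam_Icc, show a + (i.2 + 1) * (r i.1 : ℝ) - (a + i.2 * r i.1) = r i.1 by ring,
        ENNReal.ofReal_coe_nnreal]
    · simp
  refine ⟨T, ?_, fun i => (hT i).trans (hrε i.1), ?_⟩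
  · rintro ⟨x, e⟩ ⟨⟨hax, hxb⟩, he⟩
    obtain ⟨n, hn⟩ := mem_iUnion.1 (htE he)
    have hrn : (0 : ℝ) < r n := hr0 n
    have h0 : 0 ≤ (x - a) / r n := div_nonneg (sub_nonneg.2 hax) hrn.le
    refine mem_iUnion.2 ⟨(n, ⌊(x - a) / r n⌋₊), ?_⟩
    have hle : ⌊(x - a) / (r n : ℝ)⌋₊ ≤ ⌊L / r n⌋₊ := by
      refine Nat.le_floor (NNReal.coe_le_coe.1 ?_)
      push_cast
      refine (Nat.floor_le h0).trans ?_
      rw [hL, Real.coe_toNNReal _ (by linarith)]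
      gcongr
    simp only [T, if_pos hle]
    refine ⟨⟨?_, ?_⟩, hn⟩
    · have := (le_div_iff₀ hrn).1 (Nat.floor_le h0)
      dsimp only
      linarith
    · have := (div_lt_iff₀ hrn).1 (Nat.lt_floor_add_one ((x - a) / (r n : ℝ)))
      dsimp only
      linarith
  · rw [ENNReal.tsum_prod']
    calc ∑' n, ∑' j, ediam (T (n, j)) ^ (s + 1)
        ≤ ∑' n, (ENNReal.ofReal (b - a) + 1) * (r n : ℝ≥0∞) ^ s := by
          refine ENNReal.tsum_le_tsum fun n => ?_
          rw [tsum_eq_sum (s := Finset.range (⌊L / r n⌋₊ + 1))]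
          · calc ∑ j ∈ Finset.range (⌊L / r n⌋₊ + 1), ediam (T (n, j)) ^ (s + 1)
                ≤ ∑ j ∈ Finset.range (⌊L / r n⌋₊ + 1), (r n : ℝ≥0∞) ^ (s + 1) :=
                  Finset.sum_le_sum fun j _ => ENNReal.rpow_le_rpow (hT (n, j)) (by positivity)
              _ = (⌊L / r n⌋₊ * r n + r n : ℝ≥0∞) * (r n : ℝ≥0∞) ^ s := by
                  rw [Finset.sum_const, Finset.card_range, nsmul_eq_mul,
                    ENNReal.rpow_add_of_nonneg _ _ hs.le zero_le_one, ENNReal.rpow_one]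
                  push_cast
                  ring
              _ ≤ _ := by
                  gcongr
                  · have h := Nat.floor_le (zero_le (a := L / r n))
                    rw [le_div_iff₀ (hr0 n)] at h
                    change _ ≤ (L : ℝ≥0∞)
                    exact_mod_cast h
                  · exact hr1 n
          · intro j hj
            have : ¬ j ≤ ⌊L / r n⌋₊ := by simpa [Nat.lt_succ_iff] using hj
            simp only [T, if_neg this, ediam_empty]
            exact ENNReal.zero_rpow_of_pos (by positivity)
      _ ≤ _ := by rw [ENNReal.tsum_mul_left]; gcongr

theorem hausdorffMeasure_Icc_prod_eq_zero {X : Type*} [EMetricSpace X] [MeasurableSpace X]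
    [BorelSpace X] {E : Set X} {s : ℝ} (hs : 0 < s) (hE : μH[s] E = 0) (a b : ℝ) :
    μH[s + 1] (Icc a b ×ˢ E) = 0 := by
  let ε : ℕ → ℝ≥0∞ := fun k => ((k + 1 : ℕ) : ℝ≥0∞)⁻¹
  have hε : Tendsto ε atTop (𝓝 0) :=
    (tendsto_add_atTop_iff_nat 1).2 ENNReal.tendsto_inv_nat_nhds_zero
  have h0 : ∀ k, ε k ≠ 0 := fun k => ENNReal.inv_ne_zero.2 (ENNReal.natCast_ne_top _)
  have h1 : ∀ k, ε k ≤ 1 := fun k => ENNReal.inv_le_one.2 (by simp)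
  choose T hcov hdiam hsum using fun k => exists_cover_Icc_prod hs hE a b (h0 k) (h1 k)
  have hr : Tendsto (fun k => ε k ^ s⁻¹) atTop (𝓝 0) := by
    have := hε.ennrpow_const s⁻¹
    rwa [ENNReal.zero_rpow_of_pos (by positivity)] at this
  have hC : Tendsto (fun k => (ENNReal.ofReal (b - a) + 1) * ε k) atTop (𝓝 0) := by
    have := ENNReal.Tendsto.const_mul (a := ENNReal.ofReal (b - a) + 1) hε
      (Or.inr (by simp))
    rwa [mul_zero] at this
  refine le_antisymm ?_ zero_le
  calc μH[s + 1] (Icc a b ×ˢ E) ≤ liminf (fun k => ∑' i, ediam (T k i) ^ (s + 1)) atTop :=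
        hausdorffMeasure_le_liminf_tsum _ _ _ hr T (Eventually.of_forall hdiam)
          (Eventually.of_forall hcov)
    _ ≤ liminf (fun k => (ENNReal.ofReal (b - a) + 1) * ε k) atTop :=
        liminf_le_liminf (Eventually.of_forall hsum)
    _ = 0 := hC.liminf_eq

/-- Integrating over the slices of a cover bounds the Hausdorff measure of a product below. -/
theorem volume_mul_hausdorffMeasure_le_prod {X : Type*} [EMetricSpace X] [MeasurableSpace X]
    [BorelSpace X] (I : Set ℝ) (E : Set X) {s : ℝ} (hs : 0 ≤ s) :
    volume I * μH[s] E ≤ μH[s + 1] (I ×ˢ E) := by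
  rw [hausdorffMeasure_apply, hausdorffMeasure_apply]
  simp only [ENNReal.mul_iSup]
  refine iSup₂_mono fun r _ => le_iInf fun t => le_iInf fun ht => le_iInf fun hr => ?_
  set m := ⨅ (u : ℕ → Set X) (_ : E ⊆ ⋃ n, u n) (_ : ∀ n, ediam (u n) ≤ r),
    ∑' n, ⨆ _ : (u n).Nonempty, ediam (u n) ^ s with hm
  -- Cover sets are arbitrary, so their projections need a measurable hull of equal volume.
  let B : ℕ → Set ℝ := fun n => toMeasurable volume (Prod.fst '' t n)
  let F : ℝ → ℝ≥0∞ := fun x => ∑' n, (B n).indicator (fun _ => ediam (t n) ^ s) x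
  have hF : Measurable F := Measurable.tsum fun n =>
    measurable_const.indicator (measurableSet_toMeasurable _ _)
  have hslice : ∀ x ∈ I, m ≤ F x := by
    intro x hx
    have hd : ∀ n, ediam (Prod.mk x ⁻¹' t n) ≤ ediam (t n) := fun n =>
      ediam_le fun p hp q hq => by
        have := edist_le_ediam_of_mem (mem_preimage.1 hp) (mem_preimage.1 hq)
        rwa [Prod.edist_eq, edist_self, max_eq_right zero_le] at this
    refine (iInf_le_of_le (fun n => Prod.mk x ⁻¹' t n) (iInf₂_le_of_le ?_ ?_ le_rfl)).trans ?_
    · intro e he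
      simpa using ht (mk_mem_prod hx he)
    · exact fun n => (hd n).trans (hr n)
    · refine ENNReal.tsum_le_tsum fun n => iSup_le ?_
      rintro ⟨e, he⟩
      have hx' : x ∈ B n := subset_toMeasurable _ _ ⟨(x, e), he, rfl⟩
      rw [indicator_of_mem hx']
      exact ENNReal.rpow_le_rpow (hd n) hs
  calc volume I * m ≤ m * volume {x | m ≤ F x} := by
        rw [mul_comm]
        gcongr
        exact hslice
    _ ≤ ∫⁻ x, F x := mul_meas_ge_le_lintegral hF m
    _ = ∑' n, ediam (t n) ^ s * volume (Prod.fst '' t n) := by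
        rw [lintegral_tsum fun n =>
          (measurable_const.indicator (measurableSet_toMeasurable _ _)).aemeasurable]
        refine tsum_congr fun n => ?_
        rw [lintegral_indicator_const (measurableSet_toMeasurable _ _), measure_toMeasurable]
    _ ≤ _ := by
        refine ENNReal.tsum_le_tsum fun n => ?_
        rcases (t n).eq_empty_or_nonempty with h | h
        · simp [h]
        · refine le_trans ?_ (le_iSup (fun _ : (t n).Nonempty => ediam (t n) ^ (s + 1)) h)
          rw [ENNReal.rpow_add_of_nonneg _ _ hs zero_le_one, ENNReal.rpow_one]
          gcongr
          refine (Real.volume_le_diam _).trans ?_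
          simpa using (LipschitzWith.prod_fst (α := ℝ) (β := X)).ediam_image_le (t n)

/-- A product with a nondegenerate interval raises the Hausdorff dimension by one. -/
theorem dimH_Icc_prod {X : Type*} [EMetricSpace X] {a b : ℝ} (hab : a < b) {E : Set X}
    (hE : E.Nonempty) : dimH (Icc a b ×ˢ E) = dimH E + 1 := by
  borelize X
  apply le_antisymm
  · refine ENNReal.le_of_forall_pos_le_add fun δ hδ htop => ?_
    have hfin : dimH E ≠ ∞ := fun h => by simp [h] at htop
    obtain ⟨s, hs1, hs2⟩ := ENNReal.lt_iff_exists_nnreal_btwn.1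
      (ENNReal.lt_add_right hfin (ENNReal.coe_pos.2 hδ).ne')
    have hs0 : (0 : ℝ) < s := by
      have := (zero_le (a := dimH E)).trans_lt hs1
      exact_mod_cast this
    have h0 := hausdorffMeasure_Icc_prod_eq_zero hs0 (hausdorffMeasure_of_dimH_lt hs1) a b
    have h1 : dimH (Icc a b ×ˢ E) ≤ ((s + 1 : ℝ≥0) : ℝ≥0∞) :=
      dimH_le_of_hausdorffMeasure_ne_top (by
        rw [NNReal.coe_add, NNReal.coe_one, h0]
        exact ENNReal.zero_ne_top)
    calc dimH (Icc a b ×ˢ E) ≤ s + 1 := by exact_mod_cast h1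
      _ ≤ dimH E + δ + 1 := by gcongr
      _ = dimH E + 1 + δ := by ring
  · have key : ∀ s : ℝ≥0, (s : ℝ≥0∞) < dimH E → (s + 1 : ℝ≥0∞) ≤ dimH (Icc a b ×ˢ E) := by
      intro s hs
      have h := volume_mul_hausdorffMeasure_le_prod (Icc a b) E s.2
      have h1 : (((s + 1 : ℝ≥0) : ℝ≥0∞)) ≤ dimH (Icc a b ×ˢ E) :=
        le_dimH_of_hausdorffMeasure_ne_zero (by
          rw [NNReal.coe_add, NNReal.coe_one]
          refine (lt_of_lt_of_le ?_ h).ne'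
          have hs' := hausdorffMeasure_of_lt_dimH hs
          rw [NNReal.val_eq_coe, hs', Real.volume_Icc, ENNReal.mul_top]
          · exact ENNReal.zero_lt_top
          · simpa using hab)
      exact_mod_cast h1
    -- `key` is vacuous when `dimH E = 0`; this bound covers that case and justifies the truncated
    -- subtraction below.
    have hone : 1 ≤ dimH (Icc a b ×ˢ E) := by
      obtain ⟨e, he⟩ := hE
      have h1 : dimH (Icc a b) = 1 := by
        rw [Real.dimH_of_nonempty_interior (by simpa using hab)]
        simp
      rw [← h1]
      refine le_trans (dimH_mono ?_)
        ((LipschitzWith.prod_fst (α := ℝ) (β := X)).dimH_image_le (Icc a b ×ˢ E))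
      exact fun x hx => ⟨(x, e), ⟨hx, he⟩, rfl⟩
    exact add_le_of_le_tsub_right_of_le hone (ENNReal.le_of_forall_nnreal_lt fun s hs =>
      ENNReal.le_sub_of_add_le_right ENNReal.one_ne_top (key s hs))

theorem LocallyLipschitz.dimH_image_le {X Y : Type*} [EMetricSpace X] [EMetricSpace Y]
    [SecondCountableTopology X] {f : X → Y} (hf : LocallyLipschitz f) (s : Set X) :
    dimH (f '' s) ≤ dimH s :=
  dimH_image_le_of_locally_lipschitzOn fun x _ => by
    obtain ⟨K, t, ht, h⟩ := hf x
    exact ⟨K, t, mem_nhdsWithin_of_mem_nhds ht, h⟩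

/-- A surface `(x, y) ↦ φ (f x, g y)` with `φ` of class `C¹` and `f` Lipschitz has dimension at most that
of the product of the interval with the graph of `g`. -/
theorem dimH_surfaceGraph_le {a b : ℝ} (hab : a ≤ b) {B : Set ℝ} {f : Icc a b → ℝ}
    (hf : ∃ K : ℝ≥0, LipschitzWith K f) (g : B → ℝ) {φ : ℝ × ℝ → ℝ} (hφ : ContDiff ℝ 1 φ) :
    dimH (surfaceGraph fun p : Icc a b × B => φ (f p.1, g p.2))
      ≤ dimH (Icc a b ×ˢ curveGraph g) := by
  obtain ⟨K, hK⟩ := hf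
  -- Projecting onto `[a, b]` extends `f` to a Lipschitz function on the whole line.
  have hF : LipschitzWith _ (fun x => f (projIcc a b hab x)) :=
    hK.comp (LipschitzWith.projIcc hab)
  have h1 : LocallyLipschitz fun p : ℝ × EuclideanSpace ℝ (Fin 2) =>
      (p, f (projIcc a b hab p.1)) :=
    LocallyLipschitz.id.prodMk (hF.comp LipschitzWith.prod_fst).locallyLipschitz
  have h2 : ContDiff ℝ 1 fun q : (ℝ × EuclideanSpace ℝ (Fin 2)) × ℝ =>
      !₂[q.1.1, q.1.2 0, φ (q.2, q.1.2 1)] := by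
    rw [contDiff_euclidean]
    intro i
    fin_cases i <;> simp <;> fun_prop
  refine le_trans (dimH_mono ?_)
    ((h2.locallyLipschitz.comp h1).dimH_image_le (Icc a b ×ˢ curveGraph g))
  rintro _ ⟨⟨x, y⟩, rfl⟩
  refine ⟨((x : ℝ), !₂[(y : ℝ), g y]), ⟨x.2, mem_range_self y⟩, ?_⟩
  simp [projIcc_val]

/-- Subtracting `f x` from the height undoes the shear and recovers `g y`. -/
theorem dimH_prod_le_surfaceGraph_add {a b : ℝ} (hab : a ≤ b) {B : Set ℝ} {f : Icc a b → ℝ}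
    (hf : ∃ K : ℝ≥0, LipschitzWith K f) (g : B → ℝ) :
    dimH (Icc a b ×ˢ curveGraph g)
      ≤ dimH (surfaceGraph fun p : Icc a b × B => f p.1 + g p.2) := by
  obtain ⟨K, hK⟩ := hf
  have hF : LipschitzWith _ (fun x => f (projIcc a b hab x)) :=
    hK.comp (LipschitzWith.projIcc hab)
  have h0 : ContDiff ℝ 1 fun v : EuclideanSpace ℝ (Fin 3) => v 0 := by fun_prop
  have h1 : LocallyLipschitz fun v : EuclideanSpace ℝ (Fin 3) =>
      (v, f (projIcc a b hab (v 0))) :=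
    LocallyLipschitz.id.prodMk (hF.locallyLipschitz.comp h0.locallyLipschitz)
  have h2 : ContDiff ℝ 1 fun q : EuclideanSpace ℝ (Fin 3) × ℝ =>
      (q.1 0, !₂[q.1 1, q.1 2 - q.2]) := by
    refine ContDiff.prodMk (by fun_prop) (contDiff_euclidean.2 fun i => ?_)
    fin_cases i <;> simp <;> fun_prop
  refine le_trans (dimH_mono ?_) ((h2.locallyLipschitz.comp h1).dimH_image_le _)
  rintro ⟨x, _⟩ ⟨hx, ⟨y, rfl⟩⟩
  refine ⟨_, mem_range_self ((⟨x, hx⟩, y) : Icc a b × B), ?_⟩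
  simp [projIcc_of_mem hab hx]

theorem mainTheorem7 (a b c d : ℝ) (hab : a < b) (hcd : c ≤ d)
    (f : Set.Icc a b → ℝ) (hf : ∃ K : NNReal, LipschitzWith K f)
    (g : Set.Icc c d → ℝ) (hg : Continuous g) :
    dimH (surfaceGraph fun p : Set.Icc a b × Set.Icc c d => f p.1 + g p.2)
        = dimH (curveGraph g) + 1 ∧
      dimH (surfaceGraph fun p : Set.Icc a b × Set.Icc c d => f p.1 * g p.2)
        ≤ dimH (curveGraph g) + 1 := by
  have hne : (curveGraph g).Nonempty := ⟨_, mem_range_self ⟨c, left_mem_Icc.2 hcd⟩⟩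
  rw [← dimH_Icc_prod hab hne]
  exact ⟨le_antisymm (dimH_surfaceGraph_le hab.le hf g (φ := fun p => p.1 + p.2) (by fun_prop))
      (dimH_prod_le_surfaceGraph_add hab.le hf g),
    dimH_surfaceGraph_le hab.le hf g (φ := fun p => p.1 * p.2) (by fun_prop)⟩
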